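/- Let $R$ be a simple unital (not necessarily commutative) ring whose centre has at least four elements and which is generated as a ring by its invertible elements. Write $\mathrm{GL}(1,R)$ for the group of (two-sided) invertible elements of $R$. Let $\mathrm{E}(2,R)$ be the subgroup of $\mathrm{GL}(2,R)$ generated by the matrices $t_a=\begin{pmatrix}1&a\\0&1\end{pmatrix}$ ($a\in R$), $\begin{pmatrix}r&0\\0&s\end{pmatrix}$ ($r,s\in \mathrm{GL}(1,R)$) and $j=\begin{pmatrix}0&1\\1&0\end{pmatrix}$; let $\mathrm{PE}(2,R)$ be the quotient of $\mathrm{E}(2,R)$ by the scalar matrices $\begin{pmatrix}\lambda&0\\0&\lambda\end{pmatrix}$ with $\lambda$ a central invertible element of $R$; and let $\mathrm{PE}_2(2,R)$ be the subgroup of $\mathrm{PE}(2,R)$ generated by all products $e_ae_b$ ($a,b\in R$), where $e_a$ is the class of $jt_a$. Suppose that at least one of the following holds: (i) $R$ has $1$ in the stable range, that is, whenever $a,b\in R$ satisfy $Ra+Rb=R$, there is $c\in R$ such that $a+cb$ is invertible; (ii) for all $d_1,d_2,d_3\in R$, $\bigcap_{i=1}^{3}\bigl(\mathrm{GL}(1,R)-d_i\bigr)\neq\emptyset$,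 where $\mathrm{GL}(1,R)-d=\{u-d : u\in \mathrm{GL}(1,R)\}$. Then $\mathrm{PE}_2(2,R)$ is contained in every nontrivial normal subgroup of $\mathrm{PE}(2,R)$. If, in addition, the additive group of $R$ is generated by the union of the commutator subgroup $\mathrm{GL}(1,R)'$ and the set of central invertible elements, then $\mathrm{PE}_2(2,R)$ is a simple group. -/

import Mathlib

namespace ProjElem

variable (R : Type*) [Ring R]

/-- `GL(2,R)` over a possibly noncommutative ring: the two-sided invertible `2 × 2` matrices. -/
abbrev GLTwo : Type _ := (Matrix (Fin 2) (Fin 2) R)ˣ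

variable {R}

/-- The upper unitriangular matrix `t_a`. -/
def tMat (a : R) : GLTwo R where
  val := !![1, a; 0, 1]
  inv := !![1, -a; 0, 1]
  val_inv := by simp [Matrix.one_fin_two]
  inv_val := by simp [Matrix.one_fin_two]

/-- The diagonal matrix `m_{r,s}`. -/
def mMat (r s : Rˣ) : GLTwo R where
  val := !![(r : R), 0; 0, (s : R)]
  inv := !![((r⁻¹ : Rˣ) : R), 0; 0, ((s⁻¹ : Rˣ) : R)]
  val_inv := by simp [Matrix.one_fin_two]
  inv_val := by simp [Matrix.one_fin_two]

variable (R)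

/-- The transposition matrix `j`. -/
def jMat : GLTwo R where
  val := !![0, 1; 1, 0]
  inv := !![0, 1; 1, 0]
  val_inv := by simp [Matrix.one_fin_two]
  inv_val := by simp [Matrix.one_fin_two]

/-- `E(2,R)`: the subgroup of `GL(2,R)` generated by all `t_a`, all `m_{r,s}`, and `j`. -/
def E : Subgroup (GLTwo R) :=
  Subgroup.closure
    (Set.range (fun a : R => tMat a) ∪ Set.range (fun p : Rˣ × Rˣ => mMat p.1 p.2) ∪ {jMat R})

/-- The scalar matrices `diag(z, z)`, `z` a central invertible element of `R`, as a subgroup of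
`E(2,R)`. -/
def scalars : Subgroup (E R) where
  carrier := {g | ∃ z : Rˣ, (z : R) ∈ Subring.center R ∧ (g : GLTwo R) = mMat z z}
  one_mem' := ⟨1, by simp, by
    apply Units.ext
    simp [mMat, Matrix.one_fin_two]⟩
  mul_mem' := by
    rintro g h ⟨z, hz, hg⟩ ⟨w, hw, hh⟩
    refine ⟨z * w, by simpa using mul_mem hz hw, ?_⟩
    apply Units.ext
    simp [hg, hh, mMat]
  inv_mem' := by
    rintro g ⟨z, hz, hg⟩
    refine ⟨z⁻¹, ?_, ?_⟩
    · exact Set.units_inv_mem_center hz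
    · rw [Subgroup.coe_inv, hg]
      apply Units.ext
      rfl

instance scalars_normal : (scalars R).Normal where
  conj_mem := by
    rintro n ⟨z, hz, hn⟩ g
    refine ⟨z, hz, ?_⟩
    have hc : (n : GLTwo R) * (g : GLTwo R) = (g : GLTwo R) * (n : GLTwo R) := by
      rw [hn]
      apply Units.ext
      have h := fun x : R => (Subring.mem_center_iff.mp hz x).symm
      rw [Units.val_mul, Units.val_mul, Matrix.eta_fin_two ((g : GLTwo R) : Matrix _ _ R)]
      simp [mMat, h]
    rw [Subgroup.coe_mul, Subgroup.coe_mul, Subgroup.coe_inv, ← hc, mul_assoc, mul_inv_cancel,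
      mul_one, hn]

/-- The projective elementary group `PE(2,R)`. -/
abbrev PE : Type _ := E R ⧸ scalars R

variable {R}

/-- `e_a`, the class of `j t_a` in `PE(2,R)`. -/
def e (a : R) : PE R :=
  QuotientGroup.mk (s := scalars R) ⟨jMat R * tMat a,
    mul_mem (Subgroup.subset_closure (Or.inr rfl))
      (Subgroup.subset_closure (Or.inl (Or.inl ⟨a, rfl⟩)))⟩

variable (R)

/-- `PE₂(2,R)`: the subgroup of `PE(2,R)` generated by all products `e_a e_b`. -/
def PE₂ : Subgroup (PE R) :=
  Subgroup.closure {g | ∃ a b : R, g = e a * e b}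

/-- `1` is in the stable range of `R`: whenever `Ra + Rb = R`, some `a + cb` is invertible. -/
def StableRangeOne : Prop :=
  ∀ a b : R, Ideal.span {a, b} = ⊤ → ∃ c : R, IsUnit (a + c * b)

/-- Any `n` translates `GL(1,R) - d` of the set of invertibles have a common element. -/
def TranslatesMeet (n : ℕ) : Prop :=
  ∀ d : Fin n → R, (⋂ i, (fun u : R => u - d i) '' {u : R | IsUnit u}).Nonempty

/-- The elements of the commutator subgroup `GL(1,R)'`, as elements of `R`. -/
def unitCommutators : Set R := (fun u : Rˣ => (u : R)) '' (commutator Rˣ : Set Rˣ)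

/-- The invertible elements of the centre of `R`. -/
def centralUnits : Set R := {z | IsUnit z ∧ z ∈ Subring.center R}

end ProjElem

/-!
Let `N` be a subgroup of `GL(2,R)` normalized by the transvections `t_a` and `l_a`, and call the
additive group `{a | t_a ∈ N}` its level. The level is stable under `a ↦ r a s⁻¹` whenever
`diag(r, s)` normalizes `N`. So as soon as such diagonal matrices produce enough multiplications,
simplicity of `R` makes the level either `0` or `R`, and in the latter case `N` contains all
transvections.

To see that the level of a subgroup with a noncentral element is nonzero, factor an element of `N`
with invertible upper left entry as `l_y diag(r, s) t_x`. Comparing it with its conjugate by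
`diag(z, z⁻¹)`, where `z` is a central unit with `z² ≠ 1`, eliminates the diagonal factor and then
one of the two unitriangular factors. An invertible upper left entry is available after conjugation
by some `t_x` under the stable range condition; under the condition on translates, the commutator
with a suitable `t_x` has one, since `1 + a x c` is invertible together with `1 + x c a`.

If every multiplication comes from a unit, the generation of `R` by units suffices. If only
commutators of units are available and `R` is not commutative, then every additive commutator lies
in the ring generated by those commutators, because central summands drop out; if `R` is a field,
the squares and the Weyl elements of `SL(2,R)` provide the missing multiplications.
-/

namespace ProjElem

open scoped commutatorElement

section Group

variable {G : Type*} [Group G]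

theorem commutatorElement_mem_of_mem_closure {N : Subgroup G} {S : Set G} {g x : G}
    (hN : Subgroup.closure S ≤ Subgroup.normalizer N) (h : ∀ s ∈ S, ⁅g, s⁆ ∈ N)
    (hx : x ∈ Subgroup.closure S) : ⁅g, x⁆ ∈ N := by
  have hconj := Subgroup.le_normalizer_iff.mp hN
  induction hx using Subgroup.closure_induction with
  | mem s hs => exact h s hs
  | one => simp only [commutatorElement_one_right, one_mem]
  | mul s t hs _ ihs iht =>
    rw [commutatorElement_mul_right_eq_mul_conj, mul_assoc, mul_assoc, ← mul_assoc s]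
    exact mul_mem ihs (hconj s hs _ iht)
  | inv s hs ihs =>
    rw [commutatorElement_inv_right, ← commutatorElement_inv]
    simpa only [inv_inv] using hconj s⁻¹ (inv_mem hs) _ (inv_mem ihs)

theorem isSimpleGroup_of_forall_le_normalizer {H : Subgroup G} (hH : H ≠ ⊥)
    (h : ∀ N : Subgroup G, N ≤ H → H ≤ Subgroup.normalizer N → N ≠ ⊥ → H ≤ N) :
    IsSimpleGroup H := by
  have : Nontrivial H := (Subgroup.nontrivial_iff_ne_bot H).mpr hH
  refine ⟨fun K hK => or_iff_not_imp_left.mpr fun hne => ?_⟩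
  have hnorm : H ≤ Subgroup.normalizer (K.map H.subtype : Set G) := by
    simpa only [Subgroup.normalizer_eq_top, ← MonoidHom.range_eq_map, Subgroup.range_subtype]
      using K.le_normalizer_map H.subtype
  have hle := h (K.map H.subtype) (Subgroup.map_subtype_le K) hnorm
    (by rwa [Ne, Subgroup.map_eq_bot_iff_of_injective _ H.subtype_injective])
  refine eq_top_iff.mpr fun x _ => ?_
  obtain ⟨y, hy, hyx⟩ := hle x.2
  rwa [← Subtype.ext hyx]

end Group

section Ring

variable {R : Type*} [Ring R]

theorem isUnit_of_mem_center [IsSimpleRing R] {x : R} (hx : x ∈ Subring.center R) (h0 : x ≠ 0) :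
    IsUnit x := by
  let := (IsSimpleRing.isField_center R).toField
  have hx0 : (⟨x, hx⟩ : Subring.center R) ≠ 0 := fun h => h0 (congrArg Subtype.val h)
  exact (isUnit_iff_ne_zero.mpr hx0).map (Subring.center R).subtype

theorem exists_center_ne_zero_ne_one_ne_neg_one (hcard : 4 ≤ ENat.card (Subring.center R)) :
    ∃ z ∈ Subring.center R, z ≠ 0 ∧ z ≠ 1 ∧ z ≠ -1 := by
  classical
  by_contra! h
  have huniv : (Subring.center R : Set R) ⊆ ({0, 1, -1} : Finset R) := fun z hz => by
    have := h z hz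
    simp only [Finset.coe_insert, Finset.coe_singleton, Set.mem_insert_iff,
      Set.mem_singleton_iff]
    tauto
  have hle : (4 : ℕ∞) ≤ (3 : ℕ) := calc
    (4 : ℕ∞) ≤ (Subring.center R : Set R).encard := hcard
    _ ≤ (({0, 1, -1} : Finset R) : Set R).encard := Set.encard_le_encard huniv
    _ ≤ (3 : ℕ) := by
      rw [Set.encard_coe_eq_coe_finsetCard]
      exact_mod_cast Finset.card_le_three
  exact absurd hle (by norm_num)

theorem exists_center_unit [IsSimpleRing R] (hcard : 4 ≤ ENat.card (Subring.center R)) :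
    ∃ z : Rˣ, (z : R) ∈ Subring.center R ∧ ∀ a : R, z * a * z = a → a = 0 := by
  obtain ⟨z, hz, h0, h1, h2⟩ := exists_center_ne_zero_ne_one_ne_neg_one hcard
  obtain ⟨u, rfl⟩ := isUnit_of_mem_center hz h0
  have hsub : IsUnit ((u : R) - 1) :=
    isUnit_of_mem_center (sub_mem hz (one_mem _)) (sub_ne_zero.mpr h1)
  have hadd : IsUnit ((u : R) + 1) :=
    isUnit_of_mem_center (add_mem hz (one_mem _)) (mt eq_neg_of_add_eq_zero_left h2)
  refine ⟨u, hz, fun a ha => (hsub.mul hadd).mul_right_eq_zero.mp ?_⟩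
  calc ((u : R) - 1) * (u + 1) * a = u * (u * a) - a := by noncomm_ring
    _ = 0 := by rw [← Subring.mem_center_iff.mp hz a, ← mul_assoc, ha, sub_self]

open scoped Pointwise in
theorem eq_top_of_forall_mul_mul_mem [IsSimpleRing R] {A : AddSubgroup R} {a : R} (ha : a ≠ 0)
    (h : ∀ r s : R, r * a * s ∈ A) : A = ⊤ := by
  have hle : AddSubgroup.closure (Set.univ * {a} * Set.univ) ≤ A := by
    rw [AddSubgroup.closure_le]
    rintro _ ⟨_, ⟨r, -, _, rfl, rfl⟩, s, -, rfl⟩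
    exact h r s
  have hone : (1 : R) ∈ TwoSidedIdeal.span {a} := IsSimpleRing.one_mem_of_ne_zero_mem _ ha
    (TwoSidedIdeal.subset_span rfl)
  refine eq_top_iff.mpr fun x _ => hle (TwoSidedIdeal.mem_span_iff_mem_addSubgroup_closure.mp ?_)
  simpa only [mul_one] using TwoSidedIdeal.mul_mem_left _ x 1 hone

theorem eq_top_of_closure_eq_top [IsSimpleRing R] {U : Set R} (hU : Subring.closure U = ⊤)
    {A : AddSubgroup R} (hA : A ≠ ⊥) (hleft : ∀ u ∈ U, ∀ a ∈ A, u * a ∈ A)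
    (hright : ∀ u ∈ U, ∀ a ∈ A, a * u ∈ A) : A = ⊤ := by
  have hmul (x : R) : ∀ a ∈ A, x * a ∈ A ∧ a * x ∈ A := by
    induction (hU ▸ Subring.mem_top x : x ∈ Subring.closure U) using
      Subring.closure_induction with
    | mem u hu => exact fun a ha => ⟨hleft u hu a ha, hright u hu a ha⟩
    | zero => simp
    | one => simp
    | add x y _ _ hx hy =>
      intro a ha
      rw [add_mul, mul_add]
      exact ⟨add_mem (hx a ha).1 (hy a ha).1, add_mem (hx a ha).2 (hy a ha).2⟩
    | neg x _ hx =>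
      intro a ha
      rw [neg_mul, mul_neg]
      exact ⟨neg_mem (hx a ha).1, neg_mem (hx a ha).2⟩
    | mul x y _ _ hx hy =>
      intro a ha
      rw [mul_assoc x, ← mul_assoc a]
      exact ⟨(hx _ (hy a ha).1).1, (hy _ (hx a ha).2).2⟩
  obtain ⟨a, ha, ha0⟩ := A.bot_or_exists_ne_zero.resolve_left hA
  exact eq_top_of_forall_mul_mul_mem ha0 fun r s => (hmul s _ (hmul r a ha).1).2

theorem subring_eq_top_of_sup_center_eq_top [IsSimpleRing R] {S : Subring R}
    (hS : S.toAddSubgroup ⊔ (Subring.center R).toAddSubgroup = ⊤)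
    (hR : ∃ a b : R, a * b ≠ b * a) : S = ⊤ := by
  have hcomm {z : R} (hz : z ∈ Subring.center R) (x : R) : x * z = z * x :=
    Subring.mem_center_iff.mp hz x
  have hdecomp (x : R) : ∃ s ∈ S, ∃ z ∈ Subring.center R, s + z = x :=
    AddSubgroup.mem_sup.mp (hS ▸ AddSubgroup.mem_top x)
  have hbracket (a b : R) : a * b - b * a ∈ S := by
    obtain ⟨s, hs, z, hz, rfl⟩ := hdecomp a
    obtain ⟨t, ht, w, hw, rfl⟩ := hdecomp b
    have : (s + z) * (t + w) - (t + w) * (s + z) = s * t - t * s := by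
      rw [add_mul, add_mul, mul_add, mul_add, mul_add, mul_add, hcomm hw s, hcomm hw z,
        hcomm hz t]
      abel
    exact this ▸ sub_mem (mul_mem hs ht) (mul_mem ht hs)
  obtain ⟨a, b, hab⟩ := hR
  have hleft (r : R) : r * (a * b - b * a) ∈ S := by
    obtain ⟨s, hs, z, hz, rfl⟩ := hdecomp r
    have : z * (a * b - b * a) = z * a * b - b * (z * a) := by
      rw [mul_sub, ← mul_assoc b, hcomm hz, mul_assoc, mul_assoc]
    rw [add_mul, this]
    exact add_mem (mul_mem hs (hbracket a b)) (hbracket (z * a) b)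
  have htop : S.toAddSubgroup = ⊤ :=
    eq_top_of_forall_mul_mul_mem (sub_ne_zero.mpr hab) fun r r' => by
      obtain ⟨s, hs, z, hz, rfl⟩ := hdecomp r'
      rw [mul_add, hcomm hz, ← mul_assoc z]
      change _ ∈ S
      exact add_mem (mul_mem (hleft r) hs) (hleft (z * r))
  exact Subring.toAddSubgroup_injective htop

theorem eq_and_mem_center_of_forall_mul_mul_inv_eq {r s : Rˣ}
    (h : ∀ a : R, r * a * (s⁻¹ : Rˣ) = a) : r = s ∧ (r : R) ∈ Subring.center R := by
  obtain rfl : r = s := Units.ext <| by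
    rw [← Units.mul_inv_eq_one, ← mul_one (r : R), h 1]
  refine ⟨rfl, Subring.mem_center_iff.mpr fun a => ?_⟩
  rw [← Units.eq_mul_inv_iff_mul_eq, h a]

theorem isUnit_one_add_mul_swap {a b : R} (h : IsUnit (1 + a * b)) : IsUnit (1 + b * a) := by
  obtain ⟨⟨u, v, huv, hvu⟩, rfl : u = 1 + a * b⟩ := h
  -- The geometric series `1 - b (1 - ab + ⋯) a` suggests the inverse.
  refine ⟨⟨1 + b * a, 1 - b * v * a, ?_, ?_⟩, rfl⟩
  · calc (1 + b * a) * (1 - b * v * a) = 1 + b * a - b * ((1 + a * b) * v) * a := by noncomm_ring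
      _ = 1 := by rw [huv, mul_one, add_sub_cancel_right]
  · calc (1 - b * v * a) * (1 + b * a) = 1 + b * a - b * (v * (1 + a * b)) * a := by noncomm_ring
      _ = 1 := by rw [hvu, mul_one, add_sub_cancel_right]

theorem TranslatesMeet.mono {m n : ℕ} (hmn : m ≤ n) (h : TranslatesMeet R n) :
    TranslatesMeet R m := fun d => by
  obtain ⟨x, hx⟩ := h (Function.extend (Fin.castLE hmn) d 0)
  refine ⟨x, Set.mem_iInter.mpr fun i => ?_⟩
  simpa only [(Fin.castLE_injective hmn).extend_apply] using
    Set.mem_iInter.mp hx (Fin.castLE hmn i)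

theorem TranslatesMeet.exists_unit_add_eq_unit (h : TranslatesMeet R 2) (d : R) :
    ∃ u v : Rˣ, (u : R) + d = v := by
  obtain ⟨x, hx⟩ := h ![0, d]
  obtain ⟨_, ⟨u, rfl⟩, hu : (u : R) - 0 = x⟩ := Set.mem_iInter.mp hx 0
  obtain ⟨_, ⟨v, rfl⟩, hv : (v : R) - d = x⟩ := Set.mem_iInter.mp hx 1
  exact ⟨u, v, by rw [← sub_zero (u : R), hu, ← hv, sub_add_cancel]⟩

theorem TranslatesMeet.exists_isUnit_one_add_mul_mul (h : TranslatesMeet R 2) (a c : R) :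
    ∃ x : Rˣ, IsUnit (1 + a * x * c) := by
  obtain ⟨u, v, huv⟩ := h.exists_unit_add_eq_unit (c * a)
  refine ⟨u⁻¹, ?_⟩
  have hunit : (1 : R) + ↑u⁻¹ * c * a = ↑(u⁻¹ * v) := by
    rw [Units.val_mul, ← huv, mul_add, Units.inv_mul, mul_assoc]
  rw [mul_assoc]
  exact isUnit_one_add_mul_swap (hunit ▸ (u⁻¹ * v).isUnit)

end Ring

section Matrix

variable {R : Type*} [Ring R]

/-- The lower unitriangular matrix `l_a`, the transpose of `t_a`. -/
def lMat (a : R) : GLTwo R where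
  val := !![1, 0; a, 1]
  inv := !![1, 0; -a, 1]
  val_inv := by simp [Matrix.one_fin_two]
  inv_val := by simp [Matrix.one_fin_two]

/-- The Weyl element attached to a unit `r`: the antidiagonal matrix with upper right entry `r`
and lower left entry `-r⁻¹`, written as a product of unitriangular matrices. -/
def wMat (r : Rˣ) : GLTwo R := tMat (r : R) * lMat (-((r⁻¹ : Rˣ) : R)) * tMat (r : R)

@[simp] theorem tMat_inv (a : R) : (tMat a)⁻¹ = tMat (-a) := by
  apply Units.ext; simp [tMat]

@[simp] theorem lMat_inv (a : R) : (lMat a)⁻¹ = lMat (-a) := by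
  apply Units.ext; simp [lMat]

@[simp] theorem mMat_inv (r s : Rˣ) : (mMat r s)⁻¹ = mMat r⁻¹ s⁻¹ := by
  apply Units.ext; simp [mMat]

theorem jMat_inv : (jMat R)⁻¹ = jMat R := by
  apply Units.ext; simp [jMat]

@[simp] theorem tMat_zero : tMat (0 : R) = 1 := by
  apply Units.ext; simp [tMat, Matrix.one_fin_two]

@[simp] theorem lMat_zero : lMat (0 : R) = 1 := by
  apply Units.ext; simp [lMat, Matrix.one_fin_two]

theorem mMat_one_one : mMat (1 : Rˣ) 1 = 1 := by
  apply Units.ext; simp [mMat, Matrix.one_fin_two]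

theorem tMat_add (a b : R) : tMat (a + b) = tMat a * tMat b := by
  apply Units.ext; simp [tMat, add_comm]

theorem lMat_add (a b : R) : lMat (a + b) = lMat a * lMat b := by
  apply Units.ext; simp [lMat]

theorem mMat_mul (r s r' s' : Rˣ) : mMat r s * mMat r' s' = mMat (r * r') (s * s') := by
  apply Units.ext; simp [mMat]

theorem tMat_injective : Function.Injective (tMat : R → GLTwo R) := fun a b h => by
  simpa [tMat] using congrArg (fun g : GLTwo R => g.val 0 1) h

theorem mMat_conj_tMat (r s : Rˣ) (a : R) :
    mMat r s * tMat a * (mMat r s)⁻¹ = tMat (r * a * (s⁻¹ : Rˣ)) := by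
  rw [mul_inv_eq_iff_eq_mul]
  apply Units.ext; simp [tMat, mMat]

theorem mMat_inv_conj_mMat {z : Rˣ} (hz : (z : R) ∈ Subring.center R) (r s : Rˣ) :
    mMat z z⁻¹ * mMat r s * (mMat z z⁻¹)⁻¹ = mMat r s := by
  have hcomm (u : Rˣ) : Commute z u := Units.ext (Subring.mem_center_iff.mp hz u).symm
  rw [mMat_inv, mMat_mul, mMat_mul, (hcomm r).mul_inv_cancel, (hcomm s).inv_left.mul_inv_cancel]

theorem mMat_conj_lMat (r s : Rˣ) (a : R) :
    mMat r s * lMat a * (mMat r s)⁻¹ = lMat (s * a * (r⁻¹ : Rˣ)) := by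
  rw [mul_inv_eq_iff_eq_mul]
  apply Units.ext; simp [lMat, mMat]

theorem jMat_conj_tMat (a : R) : jMat R * tMat a * (jMat R)⁻¹ = lMat a := by
  apply Units.ext; simp [jMat, tMat, lMat]

theorem wMat_val (r : Rˣ) :
    (wMat r : Matrix (Fin 2) (Fin 2) R) = !![0, (r : R); -((r⁻¹ : Rˣ) : R), 0] := by
  simp [wMat, tMat, lMat]

theorem wMat_conj_tMat (r : Rˣ) (a : R) :
    wMat r * tMat a * (wMat r)⁻¹ = lMat (-((r⁻¹ : Rˣ) * a * (r⁻¹ : Rˣ))) := by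
  rw [mul_inv_eq_iff_eq_mul]
  apply Units.ext; simp [wMat_val, tMat, lMat]

theorem wMat_mul_wMat_inv (r s : Rˣ) :
    wMat r * (wMat s)⁻¹ = mMat (r * s⁻¹) (r⁻¹ * s) := by
  rw [mul_inv_eq_iff_eq_mul]
  apply Units.ext; simp [wMat_val, mMat, mul_assoc]

theorem mul_inv_apply (g : GLTwo R) (i j : Fin 2) :
    g.val i 0 * g⁻¹.val 0 j + g.val i 1 * g⁻¹.val 1 j = (1 : Matrix (Fin 2) (Fin 2) R) i j := by
  rw [← g.mul_inv, Matrix.mul_apply, Fin.sum_univ_two]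

theorem inv_mul_apply (g : GLTwo R) (i j : Fin 2) :
    g⁻¹.val i 0 * g.val 0 j + g⁻¹.val i 1 * g.val 1 j = (1 : Matrix (Fin 2) (Fin 2) R) i j := by
  simpa only [inv_inv] using mul_inv_apply g⁻¹ i j

theorem exists_eq_mMat {g : GLTwo R} (h01 : g.val 0 1 = 0) (h10 : g.val 1 0 = 0) :
    ∃ r s : Rˣ, g = mMat r s := by
  have h0 : g.val 0 0 * g⁻¹.val 0 0 = 1 := by simpa [h01] using mul_inv_apply g 0 0
  have h0' : g⁻¹.val 0 0 * g.val 0 0 = 1 := by simpa [h10] using inv_mul_apply g 0 0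
  have h1 : g.val 1 1 * g⁻¹.val 1 1 = 1 := by simpa [h10] using mul_inv_apply g 1 1
  have h1' : g⁻¹.val 1 1 * g.val 1 1 = 1 := by simpa [h01] using inv_mul_apply g 1 1
  refine ⟨⟨_, _, h0, h0'⟩, ⟨_, _, h1, h1'⟩, Units.ext ?_⟩
  exact (Matrix.eta_fin_two g.val).trans (by rw [h01, h10]; rfl)

theorem exists_eq_lMat_mul_mMat_mul_tMat {g : GLTwo R} (h : IsUnit (g.val 0 0)) :
    ∃ (y x : R) (r s : Rˣ), g = lMat y * mMat r s * tMat x := by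
  obtain ⟨u, hu⟩ := h
  set y := g.val 1 0 * (u⁻¹ : Rˣ)
  set x := (u⁻¹ : Rˣ) * g.val 0 1
  have hval : ((lMat y)⁻¹ * g * (tMat x)⁻¹).val = !![(u : R), 0; 0, g.val 1 1 - y * g.val 0 1] := by
    rw [Units.val_mul, Units.val_mul, Matrix.eta_fin_two g.val, ← hu]
    simp [lMat, tMat, x, y, neg_add_eq_sub]
  obtain ⟨r, s, hm⟩ := exists_eq_mMat (g := (lMat y)⁻¹ * g * (tMat x)⁻¹) (by rw [hval]; rfl)
    (by rw [hval]; rfl)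
  exact ⟨y, x, r, s, by rw [← hm]; group⟩

theorem mMat_self_mem_center {z : Rˣ} (hz : (z : R) ∈ Subring.center R) :
    mMat z z ∈ Subgroup.center (GLTwo R) := by
  refine Subgroup.mem_center_iff.mpr fun g => Units.ext ?_
  have hcomm (x : R) : x * z = z * x := Subring.mem_center_iff.mp hz x
  rw [Units.val_mul, Units.val_mul, Matrix.eta_fin_two g.val]
  simp [mMat, hcomm]

theorem mem_center_iff {g : GLTwo R} :
    g ∈ Subgroup.center (GLTwo R) ↔ ∃ z : Rˣ, (z : R) ∈ Subring.center R ∧ g = mMat z z := by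
  refine ⟨fun hg => ?_, ?_⟩
  · have hcomm := Subgroup.mem_center_iff.mp hg
    have h10 : g.val 1 0 = 0 := by
      simpa [tMat, Matrix.mul_apply] using
        congrArg (fun h : GLTwo R => h.val 0 0) (hcomm (tMat 1))
    have h01 : g.val 0 1 = 0 := by
      simpa [lMat, Matrix.mul_apply] using
        congrArg (fun h : GLTwo R => h.val 0 0) (hcomm (lMat 1))
    obtain ⟨r, s, rfl⟩ := exists_eq_mMat h01 h10
    obtain ⟨rfl, hr⟩ := eq_and_mem_center_of_forall_mul_mul_inv_eq (r := r) (s := s) fun x =>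
      tMat_injective (by rw [← mMat_conj_tMat, ← hcomm (tMat x), mul_inv_cancel_right])
    exact ⟨r, hr, rfl⟩
  · rintro ⟨z, hz, rfl⟩
    exact mMat_self_mem_center hz

theorem isUnit_apply_of_mul_eq_mul {g : GLTwo R} {x : Rˣ} (hc : g.val 1 0 = 0)
    (h : g.val 0 0 * x = x * g.val 1 1) : IsUnit (g.val 0 0) := by
  have hleft : g⁻¹.val 0 0 * g.val 0 0 = 1 := by simpa [hc] using inv_mul_apply g 0 0
  have hd : g.val 1 1 * g⁻¹.val 1 1 = 1 := by simpa [hc] using mul_inv_apply g 1 1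
  have hright : g.val 0 0 * (x * g⁻¹.val 1 1 * (x⁻¹ : Rˣ)) = 1 := by
    rw [← mul_assoc, ← mul_assoc, h, mul_assoc (x : R), hd, mul_one, Units.mul_inv]
  exact isUnit_iff_exists_and_exists.mpr ⟨⟨_, hright⟩, ⟨_, hleft⟩⟩

theorem isUnit_apply_of_commutatorElement_mem_center [IsSimpleRing R] {g : GLTwo R} {x : Rˣ}
    (h : ⁅g, tMat (x : R)⁆ ∈ Subgroup.center (GLTwo R)) : IsUnit (g.val 0 0) := by
  obtain ⟨z, hz, heq⟩ := mem_center_iff.mp h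
  have hcomm : g * tMat (x : R) = mMat z z * (tMat (x : R) * g) := by
    rw [← heq, commutatorElement_def]
    group
  have hentry (i j : Fin 2) := congrArg (fun k : GLTwo R => k.val i j) hcomm
  have h01 : g.val 0 0 * x + g.val 0 1 = z * (g.val 0 1 + x * g.val 1 1) := by
    simpa [tMat, mMat, Matrix.mul_apply, Matrix.vecMul, Matrix.vecHead, Matrix.vecTail] using
      hentry 0 1
  have h10 : g.val 1 0 = z * g.val 1 0 := by
    simpa [tMat, mMat, Matrix.mul_apply, Matrix.vecMul, Matrix.vecHead, Matrix.vecTail] using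
      hentry 1 0
  have h11 : g.val 1 0 * x + g.val 1 1 = z * g.val 1 1 := by
    simpa [tMat, mMat, Matrix.mul_apply, Matrix.vecMul, Matrix.vecHead, Matrix.vecTail] using
      hentry 1 1
  by_cases hz1 : (z : R) = 1
  · simp only [hz1, one_mul, add_eq_right, Units.mul_left_eq_zero] at h11
    rw [hz1, one_mul, add_comm, add_right_inj] at h01
    exact isUnit_apply_of_mul_eq_mul h11 h01
  · have hsub : IsUnit ((z : R) - 1) :=
      isUnit_of_mem_center (sub_mem hz (one_mem _)) (sub_ne_zero.mpr hz1)
    have hc : g.val 1 0 = 0 := hsub.mul_right_eq_zero.mp <| by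
      rw [sub_one_mul, ← h10, sub_self]
    have hd : g.val 1 1 = 0 := hsub.mul_right_eq_zero.mp <| by
      rw [sub_one_mul, ← h11, hc, zero_mul, zero_add, sub_self]
    simpa [hc, hd] using mul_inv_apply g 1 1

theorem commutatorElement_tMat_apply (g : GLTwo R) (x : R) :
    ⁅g, tMat x⁆.val 0 0 = 1 + g.val 0 0 * x * g⁻¹.val 1 0 := by
  calc ⁅g, tMat x⁆.val 0 0
      = g.val 0 0 * g⁻¹.val 0 0 + (g.val 0 0 * x + g.val 0 1) * g⁻¹.val 1 0 := by
        simp [commutatorElement_def, tMat, Matrix.mul_apply]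
    _ = g.val 0 0 * g⁻¹.val 0 0 + g.val 0 1 * g⁻¹.val 1 0 + g.val 0 0 * x * g⁻¹.val 1 0 := by
        rw [add_mul, add_comm (_ * _ * _), add_assoc]
    _ = 1 + g.val 0 0 * x * g⁻¹.val 1 0 := by rw [mul_inv_apply, Matrix.one_apply_eq]

end Matrix

section Elementary

variable (R : Type*) [Ring R]

/-- The elementary subgroup of `GL(2,R)`, generated by the matrices `t_a` and `l_a` only. Its image
in `PE(2,R)` is `PE₂(2,R)`. -/
def EL : Subgroup (GLTwo R) :=
  Subgroup.closure (Set.range tMat ∪ Set.range lMat)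

variable {R}

theorem tMat_mem_EL (a : R) : tMat a ∈ EL R := Subgroup.subset_closure (Or.inl ⟨a, rfl⟩)

theorem lMat_mem_EL (a : R) : lMat a ∈ EL R := Subgroup.subset_closure (Or.inr ⟨a, rfl⟩)

theorem wMat_mem_EL (r : Rˣ) : wMat r ∈ EL R :=
  mul_mem (mul_mem (tMat_mem_EL _) (lMat_mem_EL _)) (tMat_mem_EL _)

theorem mMat_inv_mem_EL (r : Rˣ) : mMat r r⁻¹ ∈ EL R := by
  simpa only [wMat_mul_wMat_inv, inv_one, mul_one] using
    mul_mem (wMat_mem_EL r) (inv_mem (wMat_mem_EL 1))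

theorem EL_le {H : Subgroup (GLTwo R)} (ht : ∀ a, tMat a ∈ H) (hl : ∀ a, lMat a ∈ H) :
    EL R ≤ H := by
  rw [EL, Subgroup.closure_le]
  rintro _ (⟨a, rfl⟩ | ⟨a, rfl⟩)
  exacts [ht a, hl a]

theorem mMat_commutatorElement_one_mem_EL (r s : Rˣ) : mMat ⁅r, s⁆ 1 ∈ EL R := by
  have h : mMat (r * s) (r * s)⁻¹ * mMat r⁻¹ r⁻¹⁻¹ * mMat s⁻¹ s⁻¹⁻¹ = mMat ⁅r, s⁆ 1 := by
    rw [mMat_mul, mMat_mul, commutatorElement_def, mul_inv_rev, inv_inv, inv_inv,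
      inv_mul_cancel_right, inv_mul_cancel]
  exact h ▸ mul_mem (mul_mem (mMat_inv_mem_EL _) (mMat_inv_mem_EL _)) (mMat_inv_mem_EL _)

theorem mMat_one_right_mem_EL {u : Rˣ} (hu : u ∈ commutator Rˣ) : mMat u 1 ∈ EL R := by
  rw [commutator_eq_closure] at hu
  induction hu using Subgroup.closure_induction with
  | mem u hu =>
    obtain ⟨r, s, rfl⟩ := hu
    exact mMat_commutatorElement_one_mem_EL r s
  | one => exact mMat_one_one (R := R) ▸ one_mem _
  | mul u v _ _ hu hv => simpa only [mMat_mul, mul_one] using mul_mem hu hv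
  | inv u _ hu => simpa only [mMat_inv, inv_one] using inv_mem hu

theorem mMat_one_left_mem_EL {u : Rˣ} (hu : u ∈ commutator Rˣ) : mMat 1 u ∈ EL R := by
  have h : mMat u 1 * mMat u⁻¹ u⁻¹⁻¹ = mMat 1 u := by
    rw [mMat_mul, mul_inv_cancel, one_mul, inv_inv]
  exact h ▸ mul_mem (mMat_one_right_mem_EL hu) (mMat_inv_mem_EL u⁻¹)

theorem tMat_mem_E (a : R) : tMat a ∈ E R := Subgroup.subset_closure (Or.inl (Or.inl ⟨a, rfl⟩))

theorem mMat_mem_E (r s : Rˣ) : mMat r s ∈ E R :=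
  Subgroup.subset_closure (Or.inl (Or.inr ⟨(r, s), rfl⟩))

theorem jMat_mem_E : jMat R ∈ E R := Subgroup.subset_closure (Or.inr rfl)

theorem lMat_mem_E (a : R) : lMat a ∈ E R :=
  jMat_conj_tMat a ▸ mul_mem (mul_mem jMat_mem_E (tMat_mem_E a)) (inv_mem jMat_mem_E)

theorem EL_le_E : EL R ≤ E R := EL_le tMat_mem_E lMat_mem_E

end Elementary

section Level

variable {R : Type*} [Ring R]

/-- The additive group of all `a` for which the transvection `t_a` lies in `N`. -/
def level (N : Subgroup (GLTwo R)) : AddSubgroup R where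
  carrier := {a | tMat a ∈ N}
  zero_mem' := by simp only [Set.mem_ofPred_eq, tMat_zero, one_mem]
  add_mem' {a b} ha hb := by simpa only [Set.mem_ofPred_eq, tMat_add] using mul_mem ha hb
  neg_mem' {a} ha := by simpa only [Set.mem_ofPred_eq, ← tMat_inv] using inv_mem ha

variable {N : Subgroup (GLTwo R)}

theorem mem_level {a : R} : a ∈ level N ↔ tMat a ∈ N := Iff.rfl

theorem level_ne_bot {a : R} (ha : a ≠ 0) (h : tMat a ∈ N) : level N ≠ ⊥ := fun hbot =>
  ha (by simpa only [hbot, AddSubgroup.mem_bot] using mem_level.mpr h)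

theorem mul_mul_mem_level {r s : Rˣ} (h : mMat r s ∈ Subgroup.normalizer N) {a : R}
    (ha : a ∈ level N) : r * a * (s⁻¹ : Rˣ) ∈ level N := by
  rw [mem_level, ← mMat_conj_tMat]
  exact (Subgroup.mem_normalizer_iff.mp h _).mp ha

variable (hN : EL R ≤ Subgroup.normalizer N)
include hN

theorem commutatorElement_mem {g h : GLTwo R} (hg : g ∈ N) (hh : h ∈ EL R) : ⁅g, h⁆ ∈ N :=
  Subgroup.commutator_le.mp (Subgroup.le_normalizer_iff_commutator_le_left.mp hN) g hg h hh

theorem lMat_mem_iff_tMat_mem {a : R} : lMat a ∈ N ↔ tMat a ∈ N := by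
  have h := Subgroup.mem_normalizer_iff.mp (hN (wMat_mem_EL 1)) (tMat a)
  rw [wMat_conj_tMat, inv_one, Units.val_one, one_mul, mul_one, ← lMat_inv, inv_mem_iff] at h
  exact h.symm

theorem EL_le_of_level_eq_top (h : level N = ⊤) : EL R ≤ N := by
  have ht (a : R) : tMat a ∈ N := mem_level.mp (h ▸ AddSubgroup.mem_top a)
  exact EL_le ht fun a => (lMat_mem_iff_tMat_mem hN).mpr (ht a)

theorem mul_mul_sub_mem_level {r s : Rˣ} (h : mMat r s ∈ N) (a : R) :
    r * a * (s⁻¹ : Rˣ) - a ∈ level N := by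
  have := commutatorElement_mem hN h (tMat_mem_EL a)
  rwa [commutatorElement_def, mMat_conj_tMat, tMat_inv, ← tMat_add, ← sub_eq_add_neg] at this

theorem level_ne_bot_of_mMat_mem {r s : Rˣ} (h : mMat r s ∈ N)
    (hc : mMat r s ∉ Subgroup.center (GLTwo R)) : level N ≠ ⊥ := fun hbot => hc <| by
  obtain ⟨rfl, hr⟩ := eq_and_mem_center_of_forall_mul_mul_inv_eq fun a => by
    simpa only [hbot, AddSubgroup.mem_bot, sub_eq_zero] using mul_mul_sub_mem_level hN h a
  exact mMat_self_mem_center hr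

-- Modulo `N`, `l_y` is the inverse of `t_x`, so it commutes with both types of generators.
theorem commutatorElement_lMat_mem {x y : R} (h : lMat y * tMat x ∈ N) {g : GLTwo R}
    (hg : g ∈ EL R) : ⁅lMat y, g⁆ ∈ N := by
  refine commutatorElement_mem_of_mem_closure hN ?_ hg
  rintro _ (⟨b, rfl⟩ | ⟨b, rfl⟩)
  · have ht : ⁅tMat x, tMat b⁆ = 1 := commutatorElement_eq_one_iff_mul_comm.mpr <| by
      rw [← tMat_add, ← tMat_add, add_comm]
    have hlt := commutatorElement_mem hN h (tMat_mem_EL b)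
    rwa [commutatorElement_mul_left_eq_conj_mul, ht, mul_one, mul_inv_cancel, one_mul] at hlt
  · have hl : ⁅lMat y, lMat b⁆ = 1 := commutatorElement_eq_one_iff_mul_comm.mpr <| by
      rw [← lMat_add, ← lMat_add, add_comm]
    exact hl ▸ one_mem N

variable {z : Rˣ} (hfix : ∀ a : R, z * a * z = a → a = 0)
include hfix

theorem level_ne_bot_of_lMat_mul_tMat_mem {x y : R} (h : lMat y * tMat x ∈ N)
    (hxy : x ≠ 0 ∨ y ≠ 0) : level N ≠ ⊥ := by
  by_cases hy : y = 0
  · subst hy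
    exact level_ne_bot (hxy.resolve_right (not_not_intro rfl)) (by simpa using h)
  · have hl := commutatorElement_lMat_mem hN h (mMat_inv_mem_EL z⁻¹)
    have hcomm : ⁅lMat y, mMat z⁻¹ z⁻¹⁻¹⁆ = lMat (y - z * y * z) := by
      rw [commutatorElement_def, mul_assoc, mul_assoc, ← mul_assoc (mMat _ _), lMat_inv,
        mMat_conj_lMat, ← lMat_add, inv_inv, mul_neg, neg_mul, ← sub_eq_add_neg]
    rw [hcomm, lMat_mem_iff_tMat_mem hN] at hl
    exact level_ne_bot (sub_ne_zero.mpr fun heq => hy (hfix y heq.symm)) hl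

theorem level_ne_bot_of_mMat_mul_tMat_mul_lMat_mem (hz : (z : R) ∈ Subring.center R) {r s : Rˣ}
    {x y : R} (h : mMat r s * tMat x * lMat y ∈ N) (hxy : x ≠ 0 ∨ y ≠ 0) : level N ≠ ⊥ := by
  have hconj := Subgroup.le_normalizer_iff.mp hN
  set m := mMat r s
  set n := mMat z z⁻¹
  set y' := (z⁻¹ : Rˣ) * y * (z⁻¹ : Rˣ)
  have hn : n * (m * tMat x * lMat y) * n⁻¹ = m * tMat (z * x * z) * lMat y' := by
    rw [← conj_mul, ← conj_mul, mMat_inv_conj_mMat hz, mMat_conj_tMat, mMat_conj_lMat, inv_inv]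
  -- The comparison of an element with its conjugate cancels the diagonal factor `m`.
  have heq : lMat y' * ((m * tMat x * lMat y)⁻¹ * (n * (m * tMat x * lMat y) * n⁻¹)) *
      (lMat y')⁻¹ = lMat (y' - y) * tMat (z * x * z - x) := by
    rw [hn, sub_eq_neg_add _ x, sub_eq_add_neg, lMat_add, tMat_add, ← lMat_inv, ← tMat_inv]
    group
  have hmem := hconj _ (lMat_mem_EL y') _ (mul_mem (inv_mem h) (hconj n (mMat_inv_mem_EL z) _ h))
  refine level_ne_bot_of_lMat_mul_tMat_mem hN hfix (heq ▸ hmem) ?_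
  by_contra! hzero
  refine hxy.elim (· (hfix x (sub_eq_zero.mp hzero.1))) (· (hfix y ?_))
  rw [mul_assoc, ← Units.eq_inv_mul_iff_mul_eq, ← Units.eq_mul_inv_iff_mul_eq]
  exact (sub_eq_zero.mp hzero.2).symm

theorem level_ne_bot_of_isUnit_apply (hz : (z : R) ∈ Subring.center R) {g : GLTwo R} (hg : g ∈ N)
    (hgc : g ∉ Subgroup.center (GLTwo R)) (h : IsUnit (g.val 0 0)) : level N ≠ ⊥ := by
  obtain ⟨y, x, r, s, rfl⟩ := exists_eq_lMat_mul_mMat_mul_tMat h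
  by_cases hxy : x ≠ 0 ∨ y ≠ 0
  · have hconj := Subgroup.le_normalizer_iff.mp hN _ (inv_mem (lMat_mem_EL y)) _ hg
    rw [mul_assoc (lMat y), inv_mul_cancel_left, inv_inv] at hconj
    exact level_ne_bot_of_mMat_mul_tMat_mul_lMat_mem hN hfix hz hconj hxy
  · obtain ⟨rfl, rfl⟩ : x = 0 ∧ y = 0 := by simpa only [not_or, not_not] using hxy
    rw [lMat_zero, tMat_zero, one_mul, mul_one] at hg hgc
    exact level_ne_bot_of_mMat_mem hN hg hgc

theorem level_ne_bot_of_stableRangeOne (hR : StableRangeOne R) (hz : (z : R) ∈ Subring.center R)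
    {g : GLTwo R} (hg : g ∈ N) (hgc : g ∉ Subgroup.center (GLTwo R)) : level N ≠ ⊥ := by
  have hspan : Ideal.span {g.val 0 0, g.val 1 0} = ⊤ := by
    rw [Ideal.eq_top_iff_one, Ideal.mem_span_pair]
    exact ⟨_, _, inv_mul_apply g 0 0⟩
  obtain ⟨x, hx⟩ := hR _ _ hspan
  refine level_ne_bot_of_isUnit_apply hN hfix hz (g := tMat x * g * (tMat x)⁻¹)
    (Subgroup.le_normalizer_iff.mp hN _ (tMat_mem_EL x) _ hg) ?_ ?_
  · rwa [mul_assoc, Subgroup.Normal.mem_comm_iff inferInstance, inv_mul_cancel_right]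
  · have : (tMat x * g * (tMat x)⁻¹).val 0 0 = g.val 0 0 + x * g.val 1 0 := by
      rw [tMat_inv, Units.val_mul, Units.val_mul, Matrix.eta_fin_two g.val]
      simp [tMat]
    rwa [this]

theorem level_ne_bot_of_translatesMeet [IsSimpleRing R] (hR : TranslatesMeet R 2)
    (hz : (z : R) ∈ Subring.center R) {g : GLTwo R} (hg : g ∈ N)
    (hgc : g ∉ Subgroup.center (GLTwo R)) : level N ≠ ⊥ := by
  obtain ⟨x, hx⟩ := hR.exists_isUnit_one_add_mul_mul (g.val 0 0) (g⁻¹.val 1 0)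
  by_cases hc : ⁅g, tMat (x : R)⁆ ∈ Subgroup.center (GLTwo R)
  · exact level_ne_bot_of_isUnit_apply hN hfix hz hg hgc
      (isUnit_apply_of_commutatorElement_mem_center hc)
  · refine level_ne_bot_of_isUnit_apply hN hfix hz
      (commutatorElement_mem hN hg (tMat_mem_EL (x : R))) hc ?_
    rwa [commutatorElement_tMat_apply]

omit hfix in
theorem level_ne_bot_of_not_le_center [IsSimpleRing R]
    (hcard : 4 ≤ ENat.card (Subring.center R)) (hR : StableRangeOne R ∨ TranslatesMeet R 2)
    (hNc : ¬ N ≤ Subgroup.center (GLTwo R)) : level N ≠ ⊥ := by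
  obtain ⟨z, hz, hfix⟩ := exists_center_unit hcard
  obtain ⟨g, hg, hgc⟩ := SetLike.not_le_iff_exists.mp hNc
  exact hR.elim (level_ne_bot_of_stableRangeOne hN hfix · hz hg hgc)
    (level_ne_bot_of_translatesMeet hN hfix · hz hg hgc)

end Level

section LevelEqTop

theorem level_eq_top_of_E_le_normalizer {R : Type*} [Ring R] [IsSimpleRing R]
    (hgen : Subring.closure {u : R | IsUnit u} = ⊤) {N : Subgroup (GLTwo R)}
    (hN : E R ≤ Subgroup.normalizer N) (hne : level N ≠ ⊥) : level N = ⊤ := by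
  refine eq_top_of_closure_eq_top hgen hne ?_ ?_
  · rintro _ ⟨u, rfl⟩ a ha
    simpa only [inv_one, Units.val_one, mul_one] using mul_mul_mem_level (hN (mMat_mem_E u 1)) ha
  · rintro _ ⟨u, rfl⟩ a ha
    simpa only [inv_inv, Units.val_one, one_mul] using mul_mul_mem_level (hN (mMat_mem_E 1 u⁻¹)) ha

theorem closure_unitCommutators_eq_top {R : Type*} [Ring R] [IsSimpleRing R]
    (hadd : AddSubgroup.closure (unitCommutators R ∪ centralUnits R) = ⊤)
    (hR : ∃ a b : R, a * b ≠ b * a) : Subring.closure (unitCommutators R) = ⊤ := by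
  refine subring_eq_top_of_sup_center_eq_top (top_le_iff.mp ?_) hR
  rw [← hadd, AddSubgroup.closure_le, Set.union_subset_iff]
  exact ⟨fun u hu => AddSubgroup.mem_sup_left (Subring.subset_closure hu),
    fun z hz => AddSubgroup.mem_sup_right hz.2⟩

theorem level_eq_top_of_closure_unitCommutators_eq_top {R : Type*} [Ring R] [IsSimpleRing R]
    (hgen : Subring.closure (unitCommutators R) = ⊤) {N : Subgroup (GLTwo R)}
    (hN : EL R ≤ Subgroup.normalizer N) (hne : level N ≠ ⊥) : level N = ⊤ := by
  refine eq_top_of_closure_eq_top hgen hne ?_ ?_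
  · rintro _ ⟨u, hu, rfl⟩ a ha
    simpa only [inv_one, Units.val_one, mul_one] using
      mul_mul_mem_level (hN (mMat_one_right_mem_EL hu)) ha
  · rintro _ ⟨u, hu, rfl⟩ a ha
    simpa only [inv_inv, Units.val_one, one_mul] using
      mul_mul_mem_level (hN (mMat_one_left_mem_EL (inv_mem hu))) ha

section Field

variable {K : Type*} [Field K] {N : Subgroup (GLTwo K)} (hN : EL K ≤ Subgroup.normalizer N)
include hN

theorem sq_mul_mem_level (x : K) {a : K} (ha : a ∈ level N) : x ^ 2 * a ∈ level N := by
  obtain rfl | hx := eq_or_ne x 0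
  · simp only [ne_eq, OfNat.ofNat_ne_zero, not_false_eq_true, zero_pow, zero_mul, zero_mem]
  · have := mul_mul_mem_level (hN (mMat_inv_mem_EL (Units.mk0 x hx))) ha
    rwa [inv_inv, Units.val_mk0, mul_right_comm, ← sq] at this

theorem wMat_mem {a : Kˣ} (ha : (a : K) ∈ level N) : wMat a ∈ N := by
  have hinv : ((a⁻¹ : Kˣ) : K) ∈ level N := by
    simpa only [sq, mul_assoc, Units.inv_mul, mul_one] using
      sq_mul_mem_level hN ((a⁻¹ : Kˣ) : K) ha
  exact mul_mem (mul_mem ha ((lMat_mem_iff_tMat_mem hN).mpr (neg_mem hinv))) ha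

theorem pow_four_sub_one_mul_mem_level (z : Kˣ) {a : Kˣ} (ha : (a : K) ∈ level N) (b : K) :
    ((z : K) ^ 4 - 1) * b ∈ level N := by
  have hza : ((z ^ 2 * a : Kˣ) : K) ∈ level N := by
    simpa only [Units.val_mul, Units.val_pow_eq_pow_val] using sq_mul_mem_level hN (z : K) ha
  have hdiag : mMat (z ^ 2) (z ^ 2)⁻¹ ∈ N := by
    have := mul_mem (wMat_mem hN hza) (inv_mem (wMat_mem hN ha))
    rwa [wMat_mul_wMat_inv, mul_inv_cancel_right, mul_inv, inv_mul_cancel_right] at this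
  have := mul_mul_sub_mem_level hN hdiag b
  rw [inv_inv, Units.val_pow_eq_pow_val] at this
  exact (by ring : (z : K) ^ 2 * b * z ^ 2 - b = (z ^ 4 - 1) * b) ▸ this

theorem level_eq_top_of_field {z : Kˣ} (hz : (z : K) ^ 2 ≠ 1) (hne : level N ≠ ⊥) :
    level N = ⊤ := by
  obtain ⟨a, ha, ha0⟩ := (level N).bot_or_exists_ne_zero.resolve_left hne
  refine (AddSubgroup.eq_top_iff' _).mpr fun b => ?_
  by_cases h2 : (2 : K) = 0
  · have h4 : (z : K) ^ 4 - 1 ≠ 0 := by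
      have : (z : K) ^ 4 - 1 = (z ^ 2 - 1) ^ 2 := by linear_combination ((z : K) ^ 2 - 1) * h2
      exact this ▸ pow_ne_zero 2 (sub_ne_zero.mpr hz)
    exact mul_div_cancel₀ b h4 ▸
      pow_four_sub_one_mul_mem_level hN z (a := Units.mk0 a ha0) ha (b / (z ^ 4 - 1))
  · -- In characteristic other than two, `b / a` is a difference of two squares.
    set x := b / (2 * 2 * a)
    have hb : (x + 1) ^ 2 * a - (x - 1) ^ 2 * a = b := calc
      (x + 1) ^ 2 * a - (x - 1) ^ 2 * a = 2 * 2 * a * x := by ring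
      _ = b := mul_div_cancel₀ b (mul_ne_zero (mul_ne_zero h2 h2) ha0)
    exact hb ▸ sub_mem (sq_mul_mem_level hN _ ha) (sq_mul_mem_level hN _ ha)

end Field

theorem level_eq_top_of_EL_le_normalizer {R : Type*} [Ring R] [IsSimpleRing R]
    (hcard : 4 ≤ ENat.card (Subring.center R))
    (hadd : AddSubgroup.closure (unitCommutators R ∪ centralUnits R) = ⊤)
    {N : Subgroup (GLTwo R)} (hN : EL R ≤ Subgroup.normalizer N) (hne : level N ≠ ⊥) :
    level N = ⊤ := by
  by_cases hcomm : ∀ a b : R, a * b = b * a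
  · have hfield : IsField R := ⟨⟨0, 1, zero_ne_one⟩, hcomm, fun h0 =>
      (isUnit_of_mem_center (Subring.mem_center_iff.mpr fun b => hcomm b _) h0).exists_right_inv⟩
    let := hfield.toField
    obtain ⟨z, -, hz⟩ := exists_center_unit hcard
    refine level_eq_top_of_field hN (z := z) (fun h1 => one_ne_zero (hz 1 ?_)) hne
    rwa [mul_one, ← sq]
  · push Not at hcomm
    exact level_eq_top_of_closure_unitCommutators_eq_top
      (closure_unitCommutators_eq_top hadd hcomm) hN hne

end LevelEqTop

section Projective

variable {R : Type*} [Ring R]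

/-- The preimage in `GL(2,R)` of a subgroup of `PE(2,R)`, through which normal subgroups of
`PE(2,R)` are studied by means of matrices. -/
def glPreimage (N : Subgroup (PE R)) : Subgroup (GLTwo R) :=
  (N.comap (QuotientGroup.mk' (scalars R))).map (E R).subtype

theorem mem_glPreimage {N : Subgroup (PE R)} {g : GLTwo R} :
    g ∈ glPreimage N ↔ ∃ h : g ∈ E R, (QuotientGroup.mk (s := scalars R) ⟨g, h⟩ : PE R) ∈ N := by
  simp [glPreimage]

theorem glPreimage_top : glPreimage (⊤ : Subgroup (PE R)) = E R := by
  rw [glPreimage, Subgroup.comap_top, ← MonoidHom.range_eq_map, Subgroup.range_subtype]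

theorem glPreimage_normalizer_le (N : Subgroup (PE R)) :
    glPreimage (Subgroup.normalizer N) ≤ Subgroup.normalizer (glPreimage N : Set (GLTwo R)) :=
  (Subgroup.map_mono (Subgroup.le_normalizer_comap _)).trans (Subgroup.le_normalizer_map _)

theorem glPreimage_le_center_iff {N : Subgroup (PE R)} :
    glPreimage N ≤ Subgroup.center (GLTwo R) ↔ N = ⊥ := by
  refine ⟨fun h => (Subgroup.eq_bot_iff_forall N).mpr fun x hx => ?_, ?_⟩
  · obtain ⟨⟨g, hg⟩, rfl⟩ := QuotientGroup.mk_surjective x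
    exact (QuotientGroup.eq_one_iff _).mpr (mem_center_iff.mp (h (mem_glPreimage.mpr ⟨hg, hx⟩)))
  · rintro rfl g hg
    obtain ⟨h, hg⟩ := mem_glPreimage.mp hg
    exact mem_center_iff.mpr ((QuotientGroup.eq_one_iff _).mp (Subgroup.mem_bot.mp hg))

theorem e_mul_e (a b : R) : e a * e b =
    QuotientGroup.mk (s := scalars R) ⟨lMat a * tMat b, mul_mem (lMat_mem_E a) (tMat_mem_E b)⟩ := by
  refine congrArg (QuotientGroup.mk (s := scalars R)) (Subtype.ext ?_)
  change jMat R * tMat a * (jMat R * tMat b) = lMat a * tMat b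
  rw [← jMat_conj_tMat, jMat_inv, mul_assoc (jMat R * tMat a)]

theorem lMat_mul_tMat_mem_glPreimage_iff {N : Subgroup (PE R)} {a b : R} :
    lMat a * tMat b ∈ glPreimage N ↔ e a * e b ∈ N := by
  rw [mem_glPreimage, e_mul_e]
  exact exists_prop_of_true _

theorem EL_le_glPreimage_iff {N : Subgroup (PE R)} : EL R ≤ glPreimage N ↔ PE₂ R ≤ N := by
  rw [PE₂, Subgroup.closure_le]
  refine ⟨?_, fun h => ?_⟩
  · rintro h _ ⟨a, b, rfl⟩
    exact lMat_mul_tMat_mem_glPreimage_iff.mp (h (mul_mem (lMat_mem_EL a) (tMat_mem_EL b)))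
  · have hmem (a b : R) : lMat a * tMat b ∈ glPreimage N :=
      lMat_mul_tMat_mem_glPreimage_iff.mpr (h ⟨a, b, rfl⟩)
    exact EL_le (fun b => by simpa using hmem 0 b) fun a => by simpa using hmem a 0

theorem PE₂_ne_bot [Nontrivial R] : PE₂ R ≠ ⊥ := fun h => by
  have hle := (EL_le_glPreimage_iff.mpr h.le).trans (glPreimage_le_center_iff.mpr rfl)
  obtain ⟨z, -, hz⟩ := mem_center_iff.mp (hle (tMat_mem_EL (1 : R)))
  simpa [tMat, mMat] using congrArg (fun g : GLTwo R => g.val 0 1) hz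

end Projective

end ProjElem

open ProjElem in
theorem mainTheorem3_general {R : Type*} [Ring R] [IsSimpleRing R]
    (hcentre : 4 ≤ ENat.card (Subring.center R))
    (hgen : Subring.closure {u : R | IsUnit u} = ⊤)
    (hR : StableRangeOne R ∨ TranslatesMeet R 2) :
    (∀ N : Subgroup (PE R), N.Normal → N ≠ ⊥ → PE₂ R ≤ N) ∧
    (AddSubgroup.closure (unitCommutators R ∪ centralUnits R) = ⊤ → IsSimpleGroup (PE₂ R)) := by
  have hlevel {N : Subgroup (PE R)} (hN : EL R ≤ Subgroup.normalizer (glPreimage N))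
      (hne : N ≠ ⊥) : level (glPreimage N) ≠ ⊥ :=
    level_ne_bot_of_not_le_center hN hcentre hR (mt glPreimage_le_center_iff.mp hne)
  refine ⟨fun N hNormal hne => ?_, fun hadd => ?_⟩
  · have hN : E R ≤ Subgroup.normalizer (glPreimage N) := by
      simpa only [Subgroup.normalizer_eq_top, glPreimage_top] using glPreimage_normalizer_le N
    have hEL := EL_le_E.trans hN
    exact EL_le_glPreimage_iff.mp <| EL_le_of_level_eq_top hEL <|
      level_eq_top_of_E_le_normalizer hgen hN (hlevel hEL hne)
  · refine isSimpleGroup_of_forall_le_normalizer PE₂_ne_bot fun N _ hPE₂ hne => ?_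
    have hN := (EL_le_glPreimage_iff.mpr hPE₂).trans (glPreimage_normalizer_le N)
    exact EL_le_glPreimage_iff.mp <| EL_le_of_level_eq_top hN <|
      level_eq_top_of_EL_le_normalizer hcentre hadd hN (hlevel hN hne)

theorem mainTheorem3 {R : Type*} [Ring R] [IsSimpleRing R]
    (hcentre : 4 ≤ ENat.card (Subring.center R))
    (hgen : Subring.closure {u : R | IsUnit u} = ⊤)
    (hR : ProjElem.StableRangeOne R ∨ ProjElem.TranslatesMeet R 3) :
    (∀ N : Subgroup (ProjElem.PE R), N.Normal → N ≠ ⊥ → ProjElem.PE₂ R ≤ N) ∧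
    (AddSubgroup.closure (ProjElem.unitCommutators R ∪ ProjElem.centralUnits R) = ⊤ →
      IsSimpleGroup (ProjElem.PE₂ R)) :=
  mainTheorem3_general hcentre hgen (hR.imp_right (·.mono (by norm_num)))
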